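/- Let $r\ge 1$ be an integer. All graphs are finite and simple. For a graph $G$, a set $A\subseteq V(G)$ is called $r$-independent if every connected component of the induced subgraph $G[A]$ has at most $r$ vertices; $\mathrm{Ind}_r(G)$ is the simplicial complex whose faces are the $r$-independent subsets of $V(G)$. A (not necessarily pure) simplicial complex is shellable if its facets can be ordered $F_1,\dots,F_t$ so that for every $k>1$ the complex $\langle F_k\rangle\cap\langle F_1,\dots,F_{k-1}\rangle$ is pure and $(\dim F_k-1)$-dimensional, where $\langle\mathcal F\rangle$ is the complex generated by $\mathcal F$ and the empty set counts as a face of dimension $-1$. For $n\ge 3$, an $n$-clique cycle $\mathrm{CC}(B_1,\dots,B_n)$ is a graph that is the union of complete graphs $B_1,\dots,B_n$ (indices modulo $n$) such that consecutive cliques $B_i$ and $B_{i+1}$ have exactly one vertex $x_i$ in common, the vertices $x_1,\dots,x_n$ (the connecting vertices) are distinct, and non-consecutive cliques are disjoint. A star-clique graph $\mathrm{SC}(x)$ with centre $x$ is the union of finitely many complete graphs, each containing $x$ and any two of which have only the vertex $x$ in common. **Theorem 5.5.** Let $G$ be a graph obtained from an $n$-clique cycle, for some $n\ge 3$, by choosing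 a nonempty set $A\subseteq\{x_1,\dots,x_n\}$ of connecting vertices and attaching to each $x\in A$ a star-clique graph $\mathrm{SC}(x)$ at its centre $x$ (so that $\mathrm{SC}(x)$ shares only $x$ with the clique cycle, and the graphs $\mathrm{SC}(x)$, $x\in A$, are pairwise disjoint). Suppose that $|V(\mathrm{SC}(x))|\ge r+1$ for at least one $x\in A$. Then $\mathrm{Ind}_r(G)$ is shellable. -/

import Mathlib

/-! ### Simplicial complexes and shellability

A simplicial complex on a finite vertex set `V`, with the empty set counted as a face, is a family of
finite subsets of `V` that is closed under taking subsets, i.e. a `LowerSet (Finset V)`. -/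

namespace Shelling

variable {V : Type*}

/-- The facets of a complex: its faces that are maximal under inclusion. -/
def facets (Δ : LowerSet (Finset V)) : Set (Finset V) :=
  {F | Maximal (fun F' => F' ∈ Δ) F}

/-- The dimension of a face, one less than the number of its vertices (so `dim ∅ = -1`). -/
def dim (F : Finset V) : ℤ := (F.card : ℤ) - 1

/-- The complex `Δ` has a facet and all its facets have dimension `d`: it is pure and
`d`-dimensional. -/
def IsPureOfDim (Δ : LowerSet (Finset V)) (d : ℤ) : Prop :=
  (facets Δ).Nonempty ∧ ∀ F ∈ facets Δ, dim F = d

/-- (Nonpure) shellability: the facets can be listed without repetition as `F 0, F 1, …, F (t - 1)` so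
that, for every `k` but the first, the complex `⟨F k⟩ ∩ ⟨F i : i < k⟩` is pure and
`(dim (F k) - 1)`-dimensional. The complex `⟨F⟩` generated by `F` is `LowerSet.Iic F`. -/
def Shellable (Δ : LowerSet (Finset V)) : Prop :=
  ∃ (t : ℕ) (F : Fin t → Finset V), Function.Injective F ∧ Set.range F = facets Δ ∧
    ∀ k : Fin t, 0 < (k : ℕ) →
      IsPureOfDim (LowerSet.Iic (F k) ⊓ ⨆ i : Fin t, ⨆ _ : i < k, LowerSet.Iic (F i))
        (dim (F k) - 1)

end Shelling

namespace SimpleGraph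

variable {V : Type*}

/-! ### Higher independence complexes -/

/-- A set `A` of vertices is `r`-independent in `G` if every connected component of the induced
subgraph `G[A]` has at most `r` vertices. -/
def IsRIndep (G : SimpleGraph V) (r : ℕ) (A : Finset V) : Prop :=
  ∀ c : (G.induce (A : Set V)).ConnectedComponent, c.supp.ncard ≤ r

theorem IsRIndep.mono {G : SimpleGraph V} {r : ℕ} {A B : Finset V} (hBA : B ⊆ A)
    (hA : G.IsRIndep r A) : G.IsRIndep r B := by
  have hsub : (B : Set V) ⊆ (A : Set V) := by exact_mod_cast hBA
  intro c
  refine le_trans ?_ (hA (c.map (G.induceHomOfLE hsub).toHom))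
  refine Set.ncard_le_ncard_of_injOn (G.induceHomOfLE hsub) ?_
    (G.induceHomOfLE hsub).injective.injOn (Set.toFinite _)
  intro v hv
  rw [ConnectedComponent.mem_supp_iff] at hv ⊢
  rw [← hv]
  rfl

/-- The `r`-independence complex `Ind_r(G)`. -/
def indComplex (G : SimpleGraph V) (r : ℕ) : LowerSet (Finset V) where
  carrier := {A | G.IsRIndep r A}
  lower' _ _ hBA hA := IsRIndep.mono hBA hA

/-! ### Clique cycles, star-clique graphs and attaching -/

variable {G : SimpleGraph V}

/-- The subgraph `H` is the `n`-clique cycle `CC(B₁, …, Bₙ)` with connecting vertices `x₁, …, xₙ`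
(indices modulo `n`): it is the union of the complete graphs on the sets `B i`; consecutive cliques
`B i` and `B (i + 1)` meet exactly in `x i`; the connecting vertices are distinct; and cliques that are
not consecutive are disjoint. -/
structure IsCliqueCycle (H : G.Subgraph) (n : ℕ) (B : ZMod n → Set V) (x : ZMod n → V) : Prop where
  three_le : 3 ≤ n
  verts_eq : H.verts = ⋃ i, B i
  adj_iff : ∀ u v, H.Adj u v ↔ u ≠ v ∧ ∃ i, u ∈ B i ∧ v ∈ B i
  inter_eq : ∀ i, B i ∩ B (i + 1) = {x i}
  injective : Function.Injective x
  disjoint : ∀ i j, j ≠ i → j ≠ i + 1 → i ≠ j + 1 → Disjoint (B i) (B j)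

/-- The subgraph `S` is a star-clique graph with centre `c`: it is the union of finitely many complete
graphs `C j`, all containing `c`, any two of which have only `c` in common. -/
def IsStarClique (S : G.Subgraph) (c : V) : Prop :=
  ∃ (t : ℕ) (C : Fin t → Set V),
    (∀ j, c ∈ C j) ∧
    (∀ i j, i ≠ j → C i ∩ C j = {c}) ∧
    S.verts = {c} ∪ ⋃ j, C j ∧
    ∀ u v, S.Adj u v ↔ u ≠ v ∧ ∃ j, u ∈ C j ∧ v ∈ C j

/-- `G` is obtained from its subgraph `H` by attaching, to each vertex `a` of `A`, the graph `S a` at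
its vertex `a`: `G` is the union of `H` and of the `S a` with `a ∈ A`, each such `S a` shares
with `H` only the vertex `a`, and the different `S a` are disjoint. -/
structure IsAttaching (G : SimpleGraph V) (H : G.Subgraph) (A : Set V) (S : V → G.Subgraph) :
    Prop where
  subset_verts : A ⊆ H.verts
  sup_eq_top : H ⊔ ⨆ a ∈ A, S a = ⊤
  inter_eq : ∀ a ∈ A, H.verts ∩ (S a).verts = {a}
  disjoint : ∀ a ∈ A, ∀ b ∈ A, a ≠ b → Disjoint (S a).verts (S b).verts

end SimpleGraph

/-! A vertex `v` sheds from the link of a face `X` under a weakened form of vertex decomposability.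
Facets containing `v` are listed first. Each remaining facet `F` gets a witness `σ` with `X ⊆ σ ⊆ F`
such that `insert v σ` is not a face, while `F` with any `w ∈ σ \ X` replaced by `v` is one. The
witnesses split the remaining facets into the facet sets of smaller links, so induction on the
number of vertices outside `X` applies (`ShellAbove.of_vertex`).

Call a vertex available if it lies outside `X` and can be added to `X`. Every non-connecting vertex
is simplicial: its neighbours form a clique. Such a vertex, while available, can always be shed, the
witness being read off from a connected set of `r + 1` vertices (`exists_isConn_of_simplicial`).
When only connecting vertices are available, it is enough that some `x i` is blocked, meaning that
adding it to `X` breaks independence. The cycle is then cut at `x i` into a line, and the first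
available vertex of the line can be shed (`exists_prefix`).

The large star-clique graph guarantees the blocked vertex: once its non-central vertices are all in
`X`, its centre is blocked. `shellAbove_isRIndep_of_card` carries an invariant that preserves this
through the induction. -/

open Finset

/-! ### Shellings of links and the shedding criterion -/

namespace Shelling

variable {V : Type*}

/-- The facets of the complex `P` that contain `X` can be ranked so that they form a shelling order,
which amounts to a shelling of the link of `X`. -/
def ShellAbove [DecidableEq V] (P : Finset V → Prop) (X : Finset V) : Prop :=
  ∃ ρ : Finset V → ℕ,
    (∀ F F', Maximal P F → X ⊆ F → Maximal P F' → X ⊆ F' → ρ F = ρ F' → F = F') ∧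
    ∀ F F', Maximal P F → X ⊆ F → Maximal P F' → X ⊆ F' → ρ F' < ρ F →
      ∃ F'', Maximal P F'' ∧ X ⊆ F'' ∧ ρ F'' < ρ F ∧ ∃ w ∈ F, w ∉ F' ∧ F.erase w ⊆ F''

/-- Ranks in any linear order can be replaced by counting the sets of smaller rank; this permits
lexicographic ranks. -/
theorem ShellAbove.of_linearOrder [DecidableEq V] [Finite V] {P : Finset V → Prop} {X : Finset V}
    {α : Type*} [LinearOrder α] (ρ : Finset V → α)
    (h1 : ∀ F F', Maximal P F → X ⊆ F → Maximal P F' → X ⊆ F' → ρ F = ρ F' → F = F')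
    (h2 : ∀ F F', Maximal P F → X ⊆ F → Maximal P F' → X ⊆ F' → ρ F' < ρ F →
      ∃ F'', Maximal P F'' ∧ X ⊆ F'' ∧ ρ F'' < ρ F ∧ ∃ w ∈ F, w ∉ F' ∧ F.erase w ⊆ F'') :
    ShellAbove P X := by
  classical
  have := Fintype.ofFinite V
  let N : Finset V → ℕ := fun F => #{F' : Finset V | ρ F' < ρ F}
  have hN : ∀ F F', ρ F' < ρ F → N F' < N F := by
    intro F F' h
    apply Finset.card_lt_card
    rw [Finset.ssubset_iff_of_subset]
    · exact ⟨F', by simpa using h, by simp⟩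
    · intro E hE
      simp only [Finset.mem_filter, Finset.mem_univ, true_and] at hE ⊢
      exact hE.trans h
  have hN' : ∀ F F', N F' < N F → ρ F' < ρ F := by
    intro F F' h
    by_contra hc
    rcases (not_lt.1 hc).lt_or_eq with h' | h'
    · exact absurd (hN _ _ h') h.not_gt
    · simp [N, h'] at h
  refine ⟨N, fun F F' hF hX hF' hX' he => h1 F F' hF hX hF' hX' ?_, ?_⟩
  · rcases lt_trichotomy (ρ F) (ρ F') with h | h | h
    · exact absurd (hN _ _ h) (by omega)
    · exact h
    · exact absurd (hN _ _ h) (by omega)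
  · intro F F' hF hX hF' hX' hlt
    obtain ⟨F'', a, b, c, d⟩ := h2 F F' hF hX hF' hX' (hN' _ _ hlt)
    exact ⟨F'', a, b, hN _ _ c, d⟩

theorem exists_maximal_superset [Finite V] {P : Finset V → Prop} {F : Finset V}
    (hF : P F) : ∃ M, Maximal P M ∧ F ⊆ M := by
  classical
  have := Fintype.ofFinite V
  obtain ⟨M, hM, hmax⟩ := (Set.toFinite {s | P s}).exists_le_maximal hF
  exact ⟨M, hmax, hM⟩

/-- If a facet `F'` avoiding `v` contains `σ F`, then `σ F' = σ F`: an element of `σ F'` outside `σ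
F` could be exchanged for `v`, making `insert v (σ F)` a face. So the blocks of equal witness are
exactly the facets containing that witness, and each is shelled by hypothesis. Between blocks, some
`w ∈ σ F` is missing from the earlier facet, and exchanging it for `v` leads into the first block.
-/
theorem ShellAbove.of_vertex [DecidableEq V] [Finite V] {P : Finset V → Prop}
    (hP : ∀ A B, B ⊆ A → P A → P B) {X : Finset V} {v : V} (h1 : ShellAbove P (insert v X))
    (h2 : ∀ F, Maximal P F → X ⊆ F → v ∉ F → ∃ σ, X ⊆ σ ∧ σ ⊆ F ∧ ¬ P (insert v σ) ∧
      (∀ w ∈ σ, w ∉ X → P (insert v (F.erase w))) ∧ ShellAbove P σ) :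
    ShellAbove P X := by
  classical
  have := Fintype.ofFinite V
  choose! σ hXσ hσF hσv hσw hσs using h2
  have key : ∀ F F', Maximal P F → X ⊆ F → v ∉ F → Maximal P F' → X ⊆ F' → v ∉ F' →
      σ F ⊆ F' → σ F' ⊆ σ F := by
    intro F F' hF hX hv hF' hX' hv' hsub w hw
    by_contra hwF
    have hwX : w ∉ X := fun h => hwF (hXσ F hF hX hv h)
    refine hσv F hF hX hv (hP _ _ ?_ (hσw F' hF' hX' hv' w hw hwX))
    apply Finset.insert_subset_insert
    intro z hz
    exact Finset.mem_erase.2 ⟨fun h => hwF (h ▸ hz), hsub hz⟩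
  have uniq : ∀ F F', Maximal P F → X ⊆ F → v ∉ F → Maximal P F' → X ⊆ F' → v ∉ F' →
      σ F ⊆ F' → σ F' = σ F := by
    intro F F' hF hX hv hF' hX' hv' hsub
    have h := key F F' hF hX hv hF' hX' hv' hsub
    exact h.antisymm (key F' F hF' hX' hv' hF hX hv (h.trans (hσF F hF hX hv)))
  let τ : Finset V → Finset V := fun F => if v ∈ F then insert v X else σ F
  have hτs : ∀ F, Maximal P F → X ⊆ F → ShellAbove P (τ F) := by
    intro F hF hX
    by_cases hv : v ∈ F
    · simpa [τ, hv] using h1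
    · simpa [τ, hv] using hσs F hF hX hv
  have hτF : ∀ F, Maximal P F → X ⊆ F → τ F ⊆ F := by
    intro F hF hX
    by_cases hv : v ∈ F
    · simpa [τ, hv, Finset.insert_subset_iff] using hX
    · simpa [τ, hv] using hσF F hF hX hv
  -- One ranking is fixed for each face `Y`, so that facets with the same witness are compared by
  -- the same ranking; it is the zero function where no shelling exists.
  have hsh : ∀ Y, ∃ ρ : Finset V → ℕ, ShellAbove P Y →
      (∀ F F', Maximal P F → Y ⊆ F → Maximal P F' → Y ⊆ F' → ρ F = ρ F' → F = F') ∧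
      ∀ F F', Maximal P F → Y ⊆ F → Maximal P F' → Y ⊆ F' → ρ F' < ρ F →
      ∃ F'', Maximal P F'' ∧ Y ⊆ F'' ∧ ρ F'' < ρ F ∧ ∃ w ∈ F, w ∉ F' ∧ F.erase w ⊆ F'' := by
    intro Y
    by_cases h : ShellAbove P Y
    · obtain ⟨ρ, hρ⟩ := h
      exact ⟨ρ, fun _ => hρ⟩
    · exact ⟨fun _ => 0, fun h' => absurd h' h⟩
  choose ρ hρ using hsh
  -- The number of the block: 0 is reserved for the facets containing `v`, and the order of the
  -- other blocks is arbitrary.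
  let g : Finset V → ℕ := fun F => if v ∈ F then 0 else (Fintype.equivFin (Finset V) (σ F) : ℕ) + 1
  have gτ : ∀ F F', g F = g F' → τ F = τ F' ∧ (v ∈ F ↔ v ∈ F') := by
    intro F F' h
    by_cases hv : v ∈ F <;> by_cases hv' : v ∈ F' <;> simp_all [g, τ, Fin.val_inj]
  refine ShellAbove.of_linearOrder (fun F => toLex (g F, ρ (τ F) F)) ?_ ?_
  · intro F F' hF hX hF' hX' he
    have he' := Prod.ext_iff.1 (toLex.injective he)
    have ht := (gτ F F' he'.1).1
    refine (hρ _ (hτs F hF hX)).1 F F' hF (hτF F hF hX) hF' (ht ▸ hτF F' hF' hX') ?_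
    have := he'.2
    rw [← ht] at this
    exact this
  · intro F F' hF hX hF' hX' hlt
    rw [Prod.Lex.toLex_lt_toLex] at hlt
    simp only at hlt
    by_cases heq : g F' = g F
    · obtain ⟨ht, hvv⟩ := gτ _ _ heq
      have hlt' : ρ (τ F) F' < ρ (τ F) F := by
        rcases hlt with h | h
        · omega
        · rw [ht] at h; exact h.2
      obtain ⟨F'', hF'', hτ'', hl, hw⟩ := (hρ _ (hτs F hF hX)).2 F F' hF (hτF F hF hX) hF'
        (ht ▸ hτF F' hF' hX') hlt'
      have hg : g F'' = g F ∧ τ F'' = τ F ∧ X ⊆ F'' := by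
        by_cases hv : v ∈ F
        · have hτe : τ F = insert v X := by simp [τ, hv]
          rw [hτe, Finset.insert_subset_iff] at hτ''
          exact ⟨by simp [g, hv, hτ''.1], by simp [τ, hv, hτ''.1], hτ''.2⟩
        · have hτe : τ F = σ F := by simp [τ, hv]
          rw [hτe] at hτ''
          have hv'' : v ∉ F'' := fun h => hσv F hF hX hv
            (hP _ _ (Finset.insert_subset h hτ'') hF''.prop)
          have hX'' := (hXσ F hF hX hv).trans hτ''
          have := uniq F F'' hF hX hv hF'' hX'' hv'' hτ''
          exact ⟨by simp [g, hv, hv'', this], by simp [τ, hv, hv'', this], hX''⟩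
      refine ⟨F'', hF'', hg.2.2, ?_, hw⟩
      rw [Prod.Lex.toLex_lt_toLex]
      right
      refine ⟨hg.1, ?_⟩
      simp only [hg.2.1]
      exact hl
    · have hg : g F' < g F := by
        rcases hlt with h | h
        · exact h
        · exact absurd h.1 heq
      have hv : v ∉ F := by
        intro h
        simp [g, h] at hg
      have hns : ¬ σ F ⊆ F' := by
        intro hs
        by_cases hv' : v ∈ F'
        · exact hσv F hF hX hv (hP _ _ (Finset.insert_subset hv' hs) hF'.prop)
        · have := uniq F F' hF hX hv hF' hX' hv' hs
          exact heq (by simp [g, hv, hv', this])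
      obtain ⟨w, hwσ, hwF'⟩ := Finset.not_subset.1 hns
      have hwX : w ∉ X := fun h => hwF' (hX' h)
      obtain ⟨M, hM, hsub⟩ := exists_maximal_superset (hσw F hF hX hv w hwσ hwX)
      rw [Finset.insert_subset_iff] at hsub
      refine ⟨M, hM, fun z hz => hsub.2 (Finset.mem_erase.2 ⟨fun h => hwX (h ▸ hz), hX hz⟩), ?_,
        w, hσF F hF hX hv hwσ, hwF', hsub.2⟩
      rw [Prod.Lex.toLex_lt_toLex]
      left
      simp [g, hv, hsub.1]

theorem mem_inf_iSup_Iic {t : ℕ} (F : Fin t → Finset V) (k : Fin t) (s : Finset V) :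
    s ∈ (LowerSet.Iic (F k) ⊓ ⨆ i : Fin t, ⨆ _ : i < k, LowerSet.Iic (F i)) ↔
      s ⊆ F k ∧ ∃ i < k, s ⊆ F i := by
  simp [LowerSet.mem_inf_iff, LowerSet.mem_iSup_iff]

theorem ShellAbove.shellable [DecidableEq V] [Finite V] (Δ : LowerSet (Finset V))
    (h : ShellAbove (fun F => F ∈ Δ) ∅) : Shellable Δ := by
  classical
  have := Fintype.ofFinite V
  obtain ⟨ρ, h1, h2⟩ := h
  let 𝓕 : Finset (Finset V) := {F | Maximal (fun F => F ∈ Δ) F}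
  have h𝓕 : ∀ F, F ∈ 𝓕 ↔ Maximal (fun F => F ∈ Δ) F := fun F => by simp [𝓕]
  let e := (𝓕.image ρ).orderEmbOfFin rfl
  have hex : ∀ i, ∃ F, Maximal (fun F => F ∈ Δ) F ∧ ρ F = e i := by
    intro i
    obtain ⟨F, hF, hi⟩ := Finset.mem_image.1 ((𝓕.image ρ).orderEmbOfFin_mem rfl i)
    exact ⟨F, (h𝓕 F).1 hF, hi⟩
  choose F hF hFe using hex
  have hlt : ∀ i j, i < j ↔ ρ (F i) < ρ (F j) := fun i j => by
    rw [hFe, hFe, e.lt_iff_lt]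
  have hsurj : ∀ E, Maximal (fun F => F ∈ Δ) E → ∃ i, F i = E := by
    intro E hE
    have : ρ E ∈ Set.range e := by
      rw [Finset.range_orderEmbOfFin]
      exact_mod_cast Finset.mem_image_of_mem ρ ((h𝓕 E).2 hE)
    obtain ⟨i, hi⟩ := this
    exact ⟨i, h1 _ _ (hF i) (by simp) hE (by simp) (by rw [hFe, hi])⟩
  have hinj : Function.Injective F := by
    intro i j hij
    apply e.injective
    rw [← hFe, ← hFe, hij]
  refine ⟨_, F, hinj, ?_, ?_⟩
  · ext E
    exact ⟨fun ⟨i, hi⟩ => hi ▸ hF i, fun hE => hsurj E hE⟩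
  · intro k hk
    have hstep : ∀ s : Finset V, (∃ i < k, s ⊆ F i) → s ⊆ F k →
        ∃ w ∈ F k, s ⊆ (F k).erase w ∧ ∃ i < k, (F k).erase w ⊆ F i := by
      rintro s ⟨i, hik, hsi⟩ hsk
      obtain ⟨F'', hF'', -, hl, w, hw, hwi, hsub⟩ :=
        h2 (F k) (F i) (hF k) (by simp) (hF i) (by simp) ((hlt _ _).1 hik)
      obtain ⟨j, rfl⟩ := hsurj F'' hF''
      exact ⟨w, hw, fun z hz => Finset.mem_erase.2 ⟨fun h => hwi (hsi (h ▸ hz)), hsk hz⟩, j,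
        (hlt _ _).2 hl, hsub⟩
    have hdim : ∀ w ∈ F k, dim ((F k).erase w) = dim (F k) - 1 := by
      intro w hw
      have := Finset.card_erase_add_one hw
      simp only [dim]
      omega
    constructor
    · obtain ⟨w, hw, -, i, hik, hsub⟩ := hstep ∅ ⟨⟨0, hk.trans k.2⟩, hk, by simp⟩ (by simp)
      refine ⟨(F k).erase w, (mem_inf_iSup_Iic F k _).2
        ⟨Finset.erase_subset _ _, i, hik, hsub⟩, ?_⟩
      intro s hs hle
      obtain ⟨hsk, j, hjk, hsj⟩ := (mem_inf_iSup_Iic F k s).1 hs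
      intro z hz
      refine Finset.mem_erase.2 ⟨?_, hsk hz⟩
      rintro rfl
      have hkj : F k ⊆ F j := by
        intro y hy
        by_cases hyz : y = z
        · exact hsj (hyz ▸ hz)
        · exact hsj (hle (Finset.mem_erase.2 ⟨hyz, hy⟩))
      have := (hF k).eq_of_le (hF j).prop hkj
      exact hjk.ne (hinj this).symm
    · intro s hs
      obtain ⟨hsk, hex⟩ := (mem_inf_iSup_Iic F k s).1 hs.prop
      obtain ⟨w, hw, hsw, hi⟩ := hstep s hex hsk
      have hmem := (mem_inf_iSup_Iic F k _).2 ⟨Finset.erase_subset w (F k), hi⟩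
      rw [hs.eq_of_le hmem hsw, hdim w hw]

end Shelling

/-! ### Connected vertex sets and `r`-independence -/

namespace SimpleGraph

variable {V : Type*}

/-- No proper nonempty part of `K` is closed under adjacency within `K`. -/
def IsConn (G : SimpleGraph V) (K : Finset V) : Prop :=
  ∀ T : Set V, (∃ u ∈ K, u ∈ T) → (∀ u ∈ K, u ∈ T → ∀ w ∈ K, G.Adj u w → w ∈ T) → ∀ u ∈ K, u ∈ T

theorem IsConn.union [DecidableEq V] {G : SimpleGraph V} {K K' : Finset V} (hK : G.IsConn K)
    (hK' : G.IsConn K') {v : V} (hv : v ∈ K) (hv' : v ∈ K') : G.IsConn (K ∪ K') := by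
  intro T hT hcl
  have hc : ∀ u ∈ K, u ∈ T → ∀ w ∈ K, G.Adj u w → w ∈ T := fun u hu hT w hw =>
    hcl u (by simp [hu]) hT w (by simp [hw])
  have hc' : ∀ u ∈ K', u ∈ T → ∀ w ∈ K', G.Adj u w → w ∈ T := fun u hu hT w hw =>
    hcl u (by simp [hu]) hT w (by simp [hw])
  have hvT : v ∈ T := by
    obtain ⟨u, hu, huT⟩ := hT
    rcases Finset.mem_union.1 hu with h | h
    · exact hK T ⟨u, h, huT⟩ hc v hv
    · exact hK' T ⟨u, h, huT⟩ hc' v hv'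
  intro u hu
  rcases Finset.mem_union.1 hu with h | h
  · exact hK T ⟨v, hv, hvT⟩ hc u h
  · exact hK' T ⟨v, hv', hvT⟩ hc' u h

theorem IsConn.erase [DecidableEq V] {G : SimpleGraph V} {K : Finset V} (hK : G.IsConn K) {v : V}
    (hs : ∀ u u', G.Adj v u → G.Adj v u' → u ≠ u' → G.Adj u u') : G.IsConn (K.erase v) := by
  by_cases hv : v ∈ K
  swap
  · rwa [Finset.erase_eq_of_notMem hv]
  intro T hT hcl
  obtain ⟨t, ht, htT⟩ := hT
  obtain ⟨htv, htK⟩ := Finset.mem_erase.1 ht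
  -- If `T` meets the neighbourhood of `v`, adjoining `v` to `T` keeps it closed, since the
  -- neighbours of `v` form a clique. Otherwise `T` without `v` is closed in `K`, which contradicts
  -- connectedness.
  by_cases hn : ∃ u ∈ K, u ∈ T ∧ G.Adj v u
  · obtain ⟨u, huK, huT, huv⟩ := hn
    have := hK (insert v T) ⟨t, htK, Or.inr htT⟩ ?_
    · intro z hz
      obtain ⟨hzv, hzK⟩ := Finset.mem_erase.1 hz
      exact (this z hzK).resolve_left hzv
    · intro a haK haT b hbK hab
      by_cases hbv : b = v
      · exact Or.inl hbv
      right
      have hb : b ∈ K.erase v := Finset.mem_erase.2 ⟨hbv, hbK⟩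
      by_cases hav : a = v
      · subst hav
        by_cases hub : u = b
        · exact hub ▸ huT
        · exact hcl u (Finset.mem_erase.2 ⟨huv.ne', huK⟩) huT b hb (hs u b huv hab hub)
      · exact hcl a (Finset.mem_erase.2 ⟨hav, haK⟩) (haT.resolve_left hav) b hb hab
  · have := hK (T \ {v}) ⟨t, htK, htT, htv⟩ ?_ v hv
    · exact absurd rfl this.2
    · rintro a haK ⟨haT, hav⟩ b hbK hab
      have hbv : b ≠ v := by
        rintro rfl
        exact hn ⟨a, haK, haT, hab.symm⟩
      exact ⟨hcl a (Finset.mem_erase.2 ⟨hav, haK⟩) haT b (Finset.mem_erase.2 ⟨hbv, hbK⟩) hab, hbv⟩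

theorem isConn_of_star {G : SimpleGraph V} {K : Finset V} {a : V} (ha : a ∈ K)
    (h : ∀ u ∈ K, u ≠ a → G.Adj a u) : G.IsConn K := by
  intro T ⟨t, ht, htT⟩ hcl
  have haT : a ∈ T := by
    by_cases hta : t = a
    · exact hta ▸ htT
    · exact hcl t ht htT a ha (h t ht hta).symm
  intro u hu
  by_cases hua : u = a
  · exact hua ▸ haT
  · exact hcl a ha haT u hu (h u hu hua)

theorem IsConn.insert [DecidableEq V] {G : SimpleGraph V} {K : Finset V} (hK : G.IsConn K)
    {u v : V} (hu : u ∈ K) (huv : G.Adj u v) : G.IsConn (insert v K) := by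
  have h : G.IsConn {u, v} := isConn_of_star (a := u) (by simp) (by simp [huv])
  have := hK.union h hu (by simp)
  convert this using 1
  ext z
  simp only [Finset.mem_insert, Finset.mem_union, Finset.mem_singleton]
  constructor
  · rintro (h | h) <;> simp [h]
  · rintro (h | rfl | h) <;> simp_all

theorem isRIndep_iff {G : SimpleGraph V} {r : ℕ} {A : Finset V} :
    G.IsRIndep r A ↔ ∀ K ⊆ A, G.IsConn K → K.card ≤ r := by
  classical
  constructor
  · intro h K hKA hK
    rcases K.eq_empty_or_nonempty with rfl | ⟨k, hk⟩
    · simp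
    have hkA : k ∈ (A : Set V) := by exact_mod_cast hKA hk
    let c := (G.induce (A : Set V)).connectedComponentMk ⟨k, hkA⟩
    let T : Set V := Subtype.val '' c.supp
    have hT : ∀ u ∈ K, u ∈ T := by
      apply hK T ⟨k, hk, ⟨k, hkA⟩, rfl, rfl⟩
      rintro u - ⟨⟨u, huA⟩, hu, rfl⟩ w hw huw
      have hwA : w ∈ (A : Set V) := by exact_mod_cast hKA hw
      refine ⟨⟨w, hwA⟩, ?_, rfl⟩
      rw [ConnectedComponent.mem_supp_iff] at hu ⊢
      rw [← hu]
      apply ConnectedComponent.sound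
      exact Adj.reachable (G := G.induce (A : Set V)) huw.symm
    have hcard : (K : Set V).ncard ≤ T.ncard :=
      Set.ncard_le_ncard (fun u hu => hT u (by exact_mod_cast hu)) (Set.toFinite _)
    rw [Set.ncard_coe_finset] at hcard
    rw [Set.ncard_image_of_injective _ Subtype.val_injective] at hcard
    exact hcard.trans (h c)
  · intro h c
    let T : Set V := Subtype.val '' c.supp
    have hTf : T.Finite := Set.toFinite _
    have := h hTf.toFinset ?_ ?_
    · rw [← Set.ncard_eq_toFinset_card T hTf,
        Set.ncard_image_of_injective _ Subtype.val_injective] at this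
      exact this
    · intro u hu
      rw [Set.Finite.mem_toFinset] at hu
      obtain ⟨⟨u, huA⟩, -, rfl⟩ := hu
      exact_mod_cast huA
    · rintro U ⟨t, ht, htU⟩ hcl u hu
      rw [Set.Finite.mem_toFinset] at ht hu
      obtain ⟨t, htc, rfl⟩ := ht
      obtain ⟨u, huc, rfl⟩ := hu
      rw [ConnectedComponent.mem_supp_iff] at htc huc
      have hr : (G.induce (A : Set V)).Reachable t u :=
        ConnectedComponent.exact (htc.trans huc.symm)
      rw [reachable_iff_reflTransGen] at hr
      have : (G.induce (A : Set V)).connectedComponentMk u = c ∧ (u : V) ∈ U := by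
        clear huc
        induction hr with
        | refl => exact ⟨htc, htU⟩
        | @tail b d hb hd ih =>
          have hdc : (G.induce (A : Set V)).connectedComponentMk d = c := by
            rw [← ih.1]
            exact ConnectedComponent.sound hd.symm.reachable
          refine ⟨hdc, hcl b ?_ ih.2 d ?_ hd⟩
          · rw [Set.Finite.mem_toFinset]; exact ⟨b, ih.1, rfl⟩
          · rw [Set.Finite.mem_toFinset]; exact ⟨d, hdc, rfl⟩
      exact this.2

end SimpleGraph

/-! ### Witnesses for shedding a vertex -/

namespace SimpleGraph

variable {V : Type*}

theorem exists_isConn_of_not_isRIndep {G : SimpleGraph V} {r : ℕ} {A : Finset V}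
    (h : ¬ G.IsRIndep r A) : ∃ K ⊆ A, G.IsConn K ∧ r < K.card := by
  rw [isRIndep_iff] at h
  push Not at h
  exact h

theorem not_isRIndep_of_isConn {G : SimpleGraph V} {r : ℕ} {A K : Finset V} (hKA : K ⊆ A)
    (hK : G.IsConn K) (hr : r < K.card) : ¬ G.IsRIndep r A :=
  fun h => absurd (isRIndep_iff.1 h K hKA hK) hr.not_ge

/-- Deleting a simplicial vertex keeps a set connected, so no connected set through `v` in `insert v
F` exceeds `r + 1` vertices. Two of size `r + 1` have a connected union and hence coincide; removing
any `w ≠ v` of this unique obstruction therefore destroys it. -/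
theorem exists_isConn_of_simplicial [DecidableEq V] {G : SimpleGraph V} {r : ℕ} {v : V}
    (hs : ∀ u u', G.Adj v u → G.Adj v u' → u ≠ u' → G.Adj u u') {F : Finset V}
    (hF : G.IsRIndep r F) (hvF : ¬ G.IsRIndep r (insert v F)) :
    ∃ K ⊆ insert v F, v ∈ K ∧ K.card = r + 1 ∧ G.IsConn (K.erase v) ∧ G.IsConn K ∧
      ∀ w ∈ K, w ≠ v → G.IsRIndep r (insert v (F.erase w)) := by
  have hmem : ∀ K ⊆ insert v F, G.IsConn K → r < K.card → v ∈ K := by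
    intro K hK hc hr
    by_contra hv
    exact not_isRIndep_of_isConn ((Finset.subset_insert_iff_of_notMem hv).1 hK) hc hr hF
  have hcard : ∀ K ⊆ insert v F, G.IsConn K → v ∈ K → K.card ≤ r + 1 := by
    intro K hK hc hv
    have := isRIndep_iff.1 hF (K.erase v) (Finset.subset_insert_iff.1 hK) (hc.erase hs)
    have := Finset.card_erase_add_one hv
    omega
  obtain ⟨K, hK, hc, hr⟩ := exists_isConn_of_not_isRIndep hvF
  have hv := hmem K hK hc hr
  have hKr := hcard K hK hc hv
  refine ⟨K, hK, hv, by omega, hc.erase hs, hc, ?_⟩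
  intro w hw hwv
  by_contra hcon
  obtain ⟨K', hK', hc', hr'⟩ := exists_isConn_of_not_isRIndep hcon
  have hK'F : K' ⊆ insert v F := hK'.trans (Finset.insert_subset_insert _ (Finset.erase_subset _ _))
  have hv' := hmem K' hK'F hc' hr'
  have hu := hcard (K ∪ K') (Finset.union_subset hK hK'F) (hc.union hc' hv hv') (by simp [hv])
  have he : K' = K ∪ K' := Finset.eq_of_subset_of_card_le Finset.subset_union_right (by omega)
  have : w ∈ K' := by rw [he]; simp [hw]
  have := hK' this
  simp [hwv] at this

/-- The vertices of `R` other than `c` are arranged along a line, each of them separating those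
before it from those after it in `G - c`. -/
def LineOrdered (G : SimpleGraph V) (R : Set V) (c : V) : Prop :=
  ∃ pos : V → ℕ, (∀ u ∈ R, ∀ w ∈ R, pos u = pos w → u = w) ∧
    ∀ w ∈ R, w ≠ c → ∃ L : Set V, (∀ v ∈ R, v ≠ c → (v ∈ L ↔ pos v < pos w)) ∧
      ∀ u ∈ L, ∀ u', G.Adj u u' → u ≠ c → u' ≠ c → u' ≠ w → u' ∈ L

/-- The witness is `X` together with the shortest initial segment of `F` that blocks `v`. If `w` is
a new vertex of this segment, it cuts the line, so a connected obstruction through `v` avoiding `w`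
stays before `w`. It would then lie in a shorter segment, against minimality. -/
theorem exists_prefix [DecidableEq V] {G : SimpleGraph V} {r : ℕ} {R : Set V} {c : V}
    {X : Finset V} {pos : V → ℕ} (hinj : ∀ u ∈ R, ∀ w ∈ R, pos u = pos w → u = w)
    (hcut : ∀ w ∈ R, w ≠ c → ∃ L : Set V, (∀ v ∈ R, v ≠ c → (v ∈ L ↔ pos v < pos w)) ∧
      ∀ u ∈ L, ∀ u', G.Adj u u' → u ≠ c → u' ≠ c → u' ≠ w → u' ∈ L)
    (hc : ¬ G.IsRIndep r (insert c X))
    (hR : ∀ u, u ∉ X → G.IsRIndep r (insert u X) → u ∈ R)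
    {v : V} (hvX : v ∉ X) (hvP : G.IsRIndep r (insert v X))
    (hmin : ∀ u, u ∉ X → G.IsRIndep r (insert u X) → pos v ≤ pos u)
    {F : Finset V} (hF : G.IsRIndep r F) (hXF : X ⊆ F) (hvF : v ∉ F)
    (hvF' : ¬ G.IsRIndep r (insert v F)) :
    ∃ σ, X ⊆ σ ∧ σ ⊆ F ∧ ¬ G.IsRIndep r (insert v σ) ∧
      ∀ w ∈ σ, w ∉ X → G.IsRIndep r (insert v (F.erase w)) := by
  classical
  have hFY : ∀ u ∈ F, G.IsRIndep r (insert u X) := fun u hu =>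
    hF.mono (Finset.insert_subset hu hXF)
  let σ : ℕ → Finset V := fun m => X ∪ {y ∈ F | pos y ≤ m}
  have hσ : ∀ m y, y ∈ σ m ↔ y ∈ X ∨ (y ∈ F ∧ pos y ≤ m) := by simp [σ]
  have hex : ∃ m, ¬ G.IsRIndep r (insert v (σ m)) := by
    refine ⟨F.sup pos, fun h => hvF' (h.mono (Finset.insert_subset_insert _ ?_))⟩
    intro y hy
    exact (hσ _ _).2 (Or.inr ⟨hy, Finset.le_sup hy⟩)
  have hfind := Nat.find_spec hex
  have hfmin : ∀ m < Nat.find hex, G.IsRIndep r (insert v (σ m)) := fun m hm =>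
    not_not.1 (Nat.find_min hex hm)
  set m := Nat.find hex
  refine ⟨σ m, fun y hy => (hσ _ _).2 (Or.inl hy), ?_, hfind, ?_⟩
  · intro y hy
    rcases (hσ _ _).1 hy with h | h
    · exact hXF h
    · exact h.1
  intro w hw hwX
  obtain ⟨hwF, hwm⟩ := ((hσ _ _).1 hw).resolve_left hwX
  by_contra hcon
  obtain ⟨K, hK, hKc, hKr⟩ := exists_isConn_of_not_isRIndep hcon
  have hvK : v ∈ K := by
    by_contra hv
    exact not_isRIndep_of_isConn (((Finset.subset_insert_iff_of_notMem hv).1 hK).trans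
      (Finset.erase_subset _ _)) hKc hKr hF
  have hwK : w ∉ K := by
    intro h
    have := hK h
    simp only [Finset.mem_insert, Finset.mem_erase, ne_eq, not_true_eq_false, false_and,
      or_false] at this
    exact hvF (this ▸ hwF)
  have hKY : ∀ u ∈ K, G.IsRIndep r (insert u X) := by
    intro u hu
    rcases Finset.mem_insert.1 (hK hu) with rfl | h
    · exact hvP
    · exact hFY u (Finset.mem_of_mem_erase h)
  have hne : ∀ u, G.IsRIndep r (insert u X) → u ≠ c := by
    rintro u hu rfl
    exact hc hu
  have hwR := hR w hwX (hFY w hwF)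
  have hvR := hR v hvX hvP
  obtain ⟨L, hL, hLcl⟩ := hcut w hwR (hne w (hFY w hwF))
  have hvw : pos v < pos w := by
    refine lt_of_le_of_ne (hmin w hwX (hFY w hwF)) fun h => ?_
    exact hvF (hinj v hvR w hwR h ▸ hwF)
  have hKL : ∀ u ∈ K, u ∈ L := by
    refine hKc L ⟨v, hvK, (hL v hvR (hne v hvP)).2 hvw⟩ ?_
    intro u hu huL u' hu' hadj
    refine hLcl u huL u' hadj (hne u (hKY u hu)) (hne u' (hKY u' hu')) ?_
    rintro rfl
    exact hwK hu'
  -- Truncated subtraction is harmless here: `pos v < pos w` makes `pos w` positive.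
  refine not_isRIndep_of_isConn ?_ hKc hKr (hfmin (pos w - 1) (by omega))
  intro y hy
  by_cases hyX : y ∈ X
  · exact Finset.mem_insert_of_mem ((hσ _ _).2 (Or.inl hyX))
  have := (hL y (hR y hyX (hKY y hy)) (hne y (hKY y hy))).1 (hKL y hy)
  rcases Finset.mem_insert.1 (hK hy) with rfl | h
  · simp
  · exact Finset.mem_insert_of_mem
      ((hσ _ _).2 (Or.inr ⟨Finset.mem_of_mem_erase h, by omega⟩))

/-! ### The induction over links -/

/-- The last hypothesis on `X` is the invariant. A blocked vertex stays blocked as `X` grows, and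
when `X` contains every `x i`, only simplicial vertices remain to be shed. In the third case all of
`S` is still individually addable; if no non-connecting vertex is available, then `S` lies in `X`
apart from its centre, which is therefore blocked. -/
theorem shellAbove_isRIndep_of_card [DecidableEq V] [Finite V] (G : SimpleGraph V) (r : ℕ)
    {ι : Type*} (x : ι → V)
    (hsimp : ∀ v ∉ Set.range x, ∀ u u', G.Adj v u → G.Adj v u' → u ≠ u' → G.Adj u u')
    (hline : ∀ i, LineOrdered G (Set.range x) (x i))
    (hcyc : ∀ T : Set ι, T.Nonempty → (∀ i ∈ T, ∀ j, G.Adj (x i) (x j) → j ∈ T) → T = Set.univ)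
    (a : ι) (S : Finset V) (haS : x a ∈ S) (hSr : r < S.card)
    (hS : ∀ u ∈ S, u ≠ x a → u ∉ Set.range x ∧ G.Adj (x a) u ∧ ∀ w, G.Adj u w → w ∈ S)
    (d : ℕ) : ∀ X : Finset V, (Xᶜ : Set V).ncard ≤ d → G.IsRIndep r X →
    ((∃ i, ¬ G.IsRIndep r (insert (x i) X)) ∨ (∀ i, x i ∈ X) ∨
      ((∀ u ∈ S, G.IsRIndep r (insert u X)) ∧ x a ∉ X)) →
    Shelling.ShellAbove (G.IsRIndep r) X := by
  classical
  induction d with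
  | zero =>
    intro X hX hXP _
    have hXu : ∀ u, u ∈ X := by
      intro u
      have := (Set.ncard_eq_zero (Set.toFinite _)).1 (Nat.le_zero.1 hX)
      have hu : u ∉ (Xᶜ : Set V) := by rw [this]; simp
      simpa using hu
    refine ⟨fun _ => 0, fun F F' _ hF _ hF' _ => ?_, fun F F' _ _ _ _ h => absurd h (lt_irrefl _)⟩
    exact Finset.ext fun u => iff_of_true (hF (hXu u)) (hF' (hXu u))
  | succ d ih =>
    intro X hX hXP hinv
    have hdec : ∀ X' : Finset V, X ⊆ X' → X' ≠ X → ((X' : Set V)ᶜ).ncard ≤ d := by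
      intro X' hsub hne
      have : ((X' : Set V)ᶜ).ncard < ((X : Set V)ᶜ).ncard := by
        apply Set.ncard_lt_ncard _ (Set.toFinite _)
        rw [Set.ssubset_def, Set.compl_subset_compl, Set.compl_subset_compl]
        exact ⟨by exact_mod_cast hsub, fun h => hne (Finset.Subset.antisymm (by exact_mod_cast h)
          hsub)⟩
      omega
    have hext : ∀ F, Maximal (G.IsRIndep r) F → ∀ v, v ∉ F → ¬ G.IsRIndep r (insert v F) := by
      intro F hF v hv h
      exact hv (hF.le_of_ge h (Finset.subset_insert v F) (Finset.mem_insert_self v F))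
    have hmono : ∀ A B, B ⊆ A → G.IsRIndep r A → G.IsRIndep r B := fun A B h hA => hA.mono h
    by_cases hY : ∃ v, v ∉ X ∧ G.IsRIndep r (insert v X)
    swap
    · push Not at hY
      have huniq : ∀ F, Maximal (G.IsRIndep r) F → X ⊆ F → F = X := by
        intro F hF hXF
        refine Finset.Subset.antisymm (fun u hu => ?_) hXF
        by_contra huX
        exact hY u huX (hF.prop.mono (Finset.insert_subset hu hXF))
      refine ⟨fun _ => 0, fun F F' h hF h' hF' _ => ?_,
        fun F F' _ _ _ _ h => absurd h (lt_irrefl _)⟩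
      rw [huniq F h hF, huniq F' h' hF']
    by_cases hYx : ∃ v, v ∉ X ∧ G.IsRIndep r (insert v X) ∧ v ∉ Set.range x
    · obtain ⟨v, hvX, hvP, hvx⟩ := hYx
      have hinv' : ∀ X', X ⊆ X' → G.IsRIndep r X' →
          (x a ∈ X' → x a ∉ X → (∃ i, ¬ G.IsRIndep r (insert (x i) X')) ∨ (∀ i, x i ∈ X')) →
          ((∃ i, ¬ G.IsRIndep r (insert (x i) X')) ∨ (∀ i, x i ∈ X') ∨
            ((∀ u ∈ S, G.IsRIndep r (insert u X')) ∧ x a ∉ X')) := by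
        intro X' hXX' hX'P hax
        rcases hinv with ⟨i, hi⟩ | h | ⟨-, haX⟩
        · exact Or.inl ⟨i, fun h => hi (h.mono (Finset.insert_subset_insert _ hXX'))⟩
        · exact Or.inr (Or.inl fun i => hXX' (h i))
        by_cases haX' : x a ∈ X'
        · rcases hax haX' haX with h | h
          · exact Or.inl h
          · exact Or.inr (Or.inl h)
        by_cases haP : G.IsRIndep r (insert (x a) X')
        swap
        · exact Or.inl ⟨a, haP⟩
        refine Or.inr (Or.inr ⟨?_, haX'⟩)
        intro u hu
        by_cases hua : u = x a
        · rwa [hua]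
        by_contra hcon
        obtain ⟨C, hC, hCc, hCr⟩ := exists_isConn_of_not_isRIndep hcon
        have huC : u ∈ C := by
          by_contra h
          exact not_isRIndep_of_isConn ((Finset.subset_insert_iff_of_notMem h).1 hC) hCc hCr hX'P
        have haC : x a ∉ C := by
          intro h
          rcases Finset.mem_insert.1 (hC h) with h | h
          · exact hua h.symm
          · exact haX' h
        have hCS : ∀ z ∈ C, z ∈ S := by
          refine hCc (S : Set V) ⟨u, huC, hu⟩ ?_
          intro z hz hzS w _ hzw
          exact (hS z hzS (fun h => haC (h ▸ hz))).2.2 w hzw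
        -- An obstruction `C` through `u` that misses the centre stays inside `S`. Exchanging `u`
        -- for the centre gives a star of the same size, which would block `x a`.
        have hstar : G.IsConn (insert (x a) (C.erase u)) := by
          refine isConn_of_star (Finset.mem_insert_self _ _) ?_
          intro z hz hza
          have hzC := Finset.mem_of_mem_erase ((Finset.mem_insert.1 hz).resolve_left hza)
          exact (hS z (hCS z hzC) hza).2.1
        refine not_isRIndep_of_isConn (r := r) ?_ hstar ?_ haP
        · exact Finset.insert_subset_insert _ (Finset.subset_insert_iff.1 hC)
        · rw [Finset.card_insert_of_notMem (fun h => haC (Finset.mem_of_mem_erase h)),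
            Finset.card_erase_add_one huC]
          exact hCr
      refine Shelling.ShellAbove.of_vertex hmono (v := v) ?_ ?_
      · refine ih _ (hdec _ (Finset.subset_insert _ _) fun h => hvX
          (h ▸ Finset.mem_insert_self v X)) hvP (hinv' _ (Finset.subset_insert _ _) hvP ?_)
        intro h1 h2
        exact absurd ⟨a, (Finset.mem_insert.1 h1).resolve_right h2⟩ hvx
      · intro F hF hXF hvF
        obtain ⟨K, hK, hvK, hKr, hKc, hKc', hKw⟩ := exists_isConn_of_simplicial (hsimp v hvx) hF.prop
          (hext F hF v hvF)
        have hsub : X ∪ K.erase v ⊆ F :=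
          Finset.union_subset hXF (Finset.subset_insert_iff.1 hK)
        have hP' := hF.prop.mono hsub
        have hnP : ¬ G.IsRIndep r (insert v (X ∪ K.erase v)) := by
          refine not_isRIndep_of_isConn (K := K) ?_ hKc' (by omega)
          intro z hz
          by_cases hzv : z = v <;> simp [hzv, hz]
        refine ⟨X ∪ K.erase v, Finset.subset_union_left, hsub, hnP, ?_, ?_⟩
        · intro w hw hwX
          have := (Finset.mem_union.1 hw).resolve_left hwX
          rw [Finset.mem_erase] at this
          exact hKw w this.2 this.1
        · refine ih _ (hdec _ Finset.subset_union_left fun h => by rw [h] at hnP; exact hnP hvP) hP'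
            (hinv' _ Finset.subset_union_left hP' ?_)
          intro h1 h2
          by_contra hcon
          push Not at hcon
          obtain ⟨hall, i, hi⟩ := hcon
          have haK : x a ∈ K.erase v := (Finset.mem_union.1 h1).resolve_left h2
          -- `K.erase v` is connected with exactly `r` vertices. As no connecting vertex is blocked,
          -- it must contain every connecting neighbour of its members, and so the whole cycle of
          -- connecting vertices.
          have hT := hcyc {i | x i ∈ K.erase v} ⟨a, haK⟩ ?_
          · have : i ∈ {i | x i ∈ K.erase v} := by rw [hT]; trivial
            exact hi (Finset.mem_union_right _ this)
          · intro j hj k hjk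
            by_contra hk
            refine not_isRIndep_of_isConn (r := r) ?_ (hKc.insert hj hjk) ?_ (hall k)
            · exact Finset.insert_subset_insert _ Finset.subset_union_right
            · rw [Finset.card_insert_of_notMem hk, Finset.card_erase_add_one hvK]
              omega
    · push Not at hYx
      obtain ⟨y, hyX, hyP⟩ := hY
      have hbroken : ∃ i, ¬ G.IsRIndep r (insert (x i) X) := by
        rcases hinv with h | h | ⟨h, haX⟩
        · exact h
        · obtain ⟨i, rfl⟩ := hYx y hyX hyP
          exact absurd (h i) hyX
        · refine ⟨a, not_isRIndep_of_isConn (K := S) ?_ (isConn_of_star haS fun u hu hua =>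
            (hS u hu hua).2.1) hSr⟩
          intro u hu
          by_cases hua : u = x a
          · simp [hua]
          · refine Finset.mem_insert_of_mem ?_
            by_contra huX
            exact (hS u hu hua).1 (hYx u huX (h u hu))
      obtain ⟨i, hi⟩ := hbroken
      obtain ⟨pos, hinj, hcut⟩ := hline i
      have hexm : ∃ v, (v ∉ X ∧ G.IsRIndep r (insert v X)) ∧
          ∀ u, u ∉ X → G.IsRIndep r (insert u X) → pos v ≤ pos u := by
        obtain ⟨v, hv, hmin⟩ := (Set.toFinite {v | v ∉ X ∧ G.IsRIndep r (insert v X)}).exists_minimalFor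
          pos _ ⟨y, hyX, hyP⟩
        refine ⟨v, hv, fun u hu hu' => ?_⟩
        rcases le_total (pos v) (pos u) with h | h
        · exact h
        · exact hmin ⟨hu, hu'⟩ h
      obtain ⟨v, ⟨hvX, hvP⟩, hmin⟩ := hexm
      have hbr : ∀ X', X ⊆ X' → ∃ i, ¬ G.IsRIndep r (insert (x i) X') := fun X' hXX' =>
        ⟨i, fun h => hi (h.mono (Finset.insert_subset_insert _ hXX'))⟩
      refine Shelling.ShellAbove.of_vertex hmono (v := v) ?_ ?_
      · exact ih _ (hdec _ (Finset.subset_insert _ _) fun h => hvX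
          (h ▸ Finset.mem_insert_self v X)) hvP (Or.inl (hbr _ (Finset.subset_insert _ _)))
      · intro F hF hXF hvF
        obtain ⟨σ, hXσ, hσF, hσP, hσw⟩ := exists_prefix hinj hcut hi hYx hvX hvP hmin hF.prop hXF
          hvF (hext F hF v hvF)
        refine ⟨σ, hXσ, hσF, hσP, hσw, ih _ (hdec _ hXσ fun h => hσP (h ▸ hvP))
          (hF.prop.mono hσF) (Or.inl (hbr _ hXσ))⟩

end SimpleGraph

/-! ### Clique cycles with attached star-clique graphs -/

theorem ZMod.val_succ_sub {n : ℕ} [NeZero n] {i c : ZMod n} (h : i + 1 ≠ c) :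
    (i + 1 - c).val = (i - c).val + 1 := by
  have hlt := ZMod.val_lt (i - c)
  have he : i + 1 - c = (((i - c).val + 1 : ℕ) : ZMod n) := by
    push_cast
    rw [ZMod.natCast_zmod_val]
    ring
  rw [he]
  refine ZMod.val_cast_of_lt (lt_of_le_of_ne hlt fun h' => ?_)
  rw [h', ZMod.natCast_self, sub_eq_zero] at he
  exact h he

namespace SimpleGraph

variable {V : Type*} {G : SimpleGraph V}

namespace IsCliqueCycle

variable {H : G.Subgraph} {n : ℕ} {B : ZMod n → Set V} {x : ZMod n → V}

theorem mem_self (hH : IsCliqueCycle H n B x) (i : ZMod n) : x i ∈ B i :=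
  ((hH.inter_eq i).symm.subset rfl).1

theorem mem_succ (hH : IsCliqueCycle H n B x) (i : ZMod n) : x i ∈ B (i + 1) :=
  ((hH.inter_eq i).symm.subset rfl).2

theorem mem_verts (hH : IsCliqueCycle H n B x) {i : ZMod n} {u : V} (hu : u ∈ B i) :
    u ∈ H.verts := by
  rw [hH.verts_eq]
  exact Set.mem_iUnion.2 ⟨i, hu⟩

theorem eq_or_of_mem (hH : IsCliqueCycle H n B x) {i j : ZMod n} {u : V} (hi : u ∈ B i)
    (hj : u ∈ B j) : j = i ∨ (j = i + 1 ∧ u = x i) ∨ (i = j + 1 ∧ u = x j) := by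
  by_cases h1 : j = i
  · exact Or.inl h1
  by_cases h2 : j = i + 1
  · subst h2
    exact Or.inr (Or.inl ⟨rfl, (hH.inter_eq i).subset ⟨hi, hj⟩⟩)
  by_cases h3 : i = j + 1
  · subst h3
    exact Or.inr (Or.inr ⟨rfl, (hH.inter_eq j).subset ⟨hj, hi⟩⟩)
  exact absurd hj (Set.disjoint_left.1 (hH.disjoint i j h1 h2 h3) hi)

theorem eq_or_of_connecting_mem (hH : IsCliqueCycle H n B x) {i j : ZMod n} (h : x j ∈ B i) :
    i = j ∨ i = j + 1 := by
  rcases hH.eq_or_of_mem h (hH.mem_self j) with h | ⟨_, h⟩ | ⟨h, _⟩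
  · exact Or.inl h.symm
  · exact Or.inl (hH.injective h).symm
  · exact Or.inr h

theorem adj_succ (hH : IsCliqueCycle H n B x) (i : ZMod n) : G.Adj (x i) (x (i + 1)) := by
  have := hH.three_le
  have : Fact (1 < n) := ⟨by omega⟩
  refine H.adj_sub ((hH.adj_iff _ _).2 ⟨fun h => ?_, i + 1, hH.mem_succ i, hH.mem_self _⟩)
  have := hH.injective h
  simp at this

theorem eq_univ_of_closed (hH : IsCliqueCycle H n B x) (T : Set (ZMod n)) (hT : T.Nonempty)
    (hcl : ∀ i ∈ T, ∀ j, G.Adj (x i) (x j) → j ∈ T) : T = Set.univ := by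
  have := hH.three_le
  have : NeZero n := ⟨by omega⟩
  obtain ⟨i, hi⟩ := hT
  have hk : ∀ k : ℕ, i + (k : ZMod n) ∈ T := by
    intro k
    induction k with
    | zero => simpa using hi
    | succ k ih =>
      have := hcl _ ih _ (hH.adj_succ _)
      simpa [add_assoc] using this
  refine Set.eq_univ_of_forall fun j => ?_
  have := hk (j - i).val
  simpa using this

end IsCliqueCycle

theorem IsAttaching.adj_iff {H : G.Subgraph} {A : Set V} {S : V → G.Subgraph}
    (hG : IsAttaching G H A S) (u v : V) :
    G.Adj u v ↔ H.Adj u v ∨ ∃ a ∈ A, (S a).Adj u v := by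
  have : (H ⊔ ⨆ a ∈ A, S a).Adj u v ↔ (⊤ : G.Subgraph).Adj u v := by rw [hG.sup_eq_top]
  rw [Subgraph.top_adj] at this
  rw [← this]
  simp [Subgraph.sup_adj, Subgraph.iSup_adj]

section Attaching

variable {H : G.Subgraph} {n : ℕ} {B : ZMod n → Set V} {x : ZMod n → V} {A : Set V}
  {S : V → G.Subgraph}

theorem IsAttaching.eq_of_mem (hG : IsAttaching G H A S) {a u : V} (ha : a ∈ A)
    (hu : u ∈ H.verts) (huS : u ∈ (S a).verts) : u = a :=
  (hG.inter_eq a ha).subset ⟨hu, huS⟩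

theorem IsAttaching.center_eq (hG : IsAttaching G H A S) {a b u : V} (ha : a ∈ A) (hb : b ∈ A)
    (hua : u ∈ (S a).verts) (hub : u ∈ (S b).verts) : a = b := by
  by_contra hne
  exact Set.disjoint_left.1 (hG.disjoint a ha b hb hne) hua hub

theorem IsAttaching.simplicial (hH : IsCliqueCycle H n B x) (hAx : A ⊆ Set.range x)
    (hS : ∀ a ∈ A, IsStarClique (S a) a) (hG : IsAttaching G H A S) {v : V}
    (hv : v ∉ Set.range x) {u u' : V} (hu : G.Adj v u) (hu' : G.Adj v u') (hne : u ≠ u') :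
    G.Adj u u' := by
  have hHS : ∀ a ∈ A, v ∈ H.verts → v ∉ (S a).verts := fun a ha h h' =>
    hv (hG.eq_of_mem ha h h' ▸ hAx ha)
  rcases (hG.adj_iff _ _).1 hu with h | ⟨a, ha, h⟩ <;>
    rcases (hG.adj_iff _ _).1 hu' with h' | ⟨b, hb, h'⟩
  · obtain ⟨-, i, hvi, hui⟩ := (hH.adj_iff _ _).1 h
    obtain ⟨-, j, hvj, huj⟩ := (hH.adj_iff _ _).1 h'
    rcases hH.eq_or_of_mem hvi hvj with rfl | ⟨_, h⟩ | ⟨_, h⟩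
    · exact H.adj_sub ((hH.adj_iff _ _).2 ⟨hne, _, hui, huj⟩)
    · exact absurd ⟨_, h.symm⟩ hv
    · exact absurd ⟨_, h.symm⟩ hv
  · exact absurd h'.fst_mem (hHS b hb h.fst_mem)
  · exact absurd h.fst_mem (hHS a ha h'.fst_mem)
  · obtain rfl := hG.center_eq ha hb h.fst_mem h'.fst_mem
    obtain ⟨t, C, -, hC, -, hadj⟩ := hS a ha
    obtain ⟨-, i, hvi, hui⟩ := (hadj _ _).1 h
    obtain ⟨-, j, hvj, huj⟩ := (hadj _ _).1 h'
    by_cases hij : i = j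
    · subst hij
      exact (S a).adj_sub ((hadj _ _).2 ⟨hne, _, hui, huj⟩)
    · exact absurd (hAx ha) ((hC i j hij).subset ⟨hvi, hvj⟩ ▸ hv)

theorem IsAttaching.star (hH : IsCliqueCycle H n B x)
    (hS : ∀ a ∈ A, IsStarClique (S a) a) (hG : IsAttaching G H A S) {a u : V} (ha : a ∈ A)
    (hu : u ∈ (S a).verts) (hua : u ≠ a) :
    u ∉ Set.range x ∧ G.Adj a u ∧ ∀ w, G.Adj u w → w ∈ (S a).verts := by
  refine ⟨?_, ?_, ?_⟩
  · rintro ⟨i, rfl⟩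
    exact hua (hG.eq_of_mem ha (hH.mem_verts (hH.mem_self i)) hu)
  · obtain ⟨t, C, haC, -, hverts, hadj⟩ := hS a ha
    rw [hverts] at hu
    obtain ⟨j, hj⟩ := Set.mem_iUnion.1 (hu.resolve_left hua)
    exact (S a).adj_sub ((hadj _ _).2 ⟨hua.symm, j, haC j, hj⟩)
  · intro w hw
    rcases (hG.adj_iff _ _).1 hw with h | ⟨b, hb, h⟩
    · exact absurd (hG.eq_of_mem ha h.fst_mem hu) hua
    · rw [hG.center_eq ha hb hu h.fst_mem]
      exact h.snd_mem

/-- Positions are the distances from `c` travelled around the cycle in the increasing direction. -/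
theorem IsAttaching.lineOrdered (hH : IsCliqueCycle H n B x) (hAx : A ⊆ Set.range x)
    (hG : IsAttaching G H A S) (c : ZMod n) :
    LineOrdered G (Set.range x) (x c) := by
  have := hH.three_le
  have : NeZero n := ⟨by omega⟩
  let p : ZMod n → ℕ := fun i => (i - c).val
  have hp : ∀ i j, p i = p j → i = j := fun i j h => by
    simpa using ZMod.val_injective n h
  have hsucc : ∀ i, i + 1 ≠ c → p (i + 1) = p i + 1 := fun i h => ZMod.val_succ_sub h
  have hlast : ∀ i j, i + 1 = c → p j ≤ p i := by
    rintro i j rfl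
    have h1 : p i = n - 1 := by
      have : i - (i + 1) = ((n - 1 : ℕ) : ZMod n) := by
        rw [Nat.cast_sub (by omega), ZMod.natCast_self]
        simp
      simp only [p]
      rw [this]
      exact ZMod.val_cast_of_lt (by omega)
    have h2 : p j < n := ZMod.val_lt _
    omega
  have hinv : ∀ i, Function.invFun x (x i) = i := Function.leftInverse_invFun hH.injective
  refine ⟨fun v => p (Function.invFun x v), ?_, ?_⟩
  · rintro _ ⟨i, rfl⟩ _ ⟨j, rfl⟩ h
    simp only [hinv] at h
    rw [hp i j h]
  rintro _ ⟨k, rfl⟩ hkc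
  -- Everything strictly between `x c` and `x k`: the cliques after `B c` up to `B k`, with the
  -- star-clique graphs attached before `x k`. The cut vertex `x c` may belong to `L`, which does no
  -- harm because it is excluded from all the conditions.
  let L : Set V := {u | u ≠ x k ∧ ((∃ i, i ≠ c ∧ p i ≤ p k ∧ u ∈ B i) ∨
    ∃ i, i ≠ c ∧ p i < p k ∧ x i ∈ A ∧ u ∈ (S (x i)).verts)}
  have hLH : ∀ u ∈ H.verts, u ∈ L → ∃ i, i ≠ c ∧ p i ≤ p k ∧ u ∈ B i := by
    rintro u hu ⟨-, h | ⟨i, hic, hik, hiA, hui⟩⟩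
    · exact h
    · rw [hG.eq_of_mem hiA hu hui]
      exact ⟨i, hic, hik.le, hH.mem_self i⟩
  have hLx : ∀ j, j ≠ c → (x j ∈ L ↔ p j < p k) := by
    intro j hj
    constructor
    · intro h
      obtain ⟨i, hic, hik, hji⟩ := hLH _ (hH.mem_verts (hH.mem_self j)) h
      have hjk : p j ≠ p k := fun he => h.1 (by rw [hp j k he])
      rcases hH.eq_or_of_connecting_mem hji with rfl | rfl
      · omega
      · have := hsucc j hic
        omega
    · intro h
      exact ⟨fun he => h.ne (by rw [hH.injective he]), Or.inl ⟨j, hj, h.le, hH.mem_self j⟩⟩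
  refine ⟨L, ?_, ?_⟩
  · rintro _ ⟨j, rfl⟩ hj
    simp only [hinv]
    exact hLx j (fun h => hj (by rw [h]))
  intro u hu u' hadj huc hu'c hu'k
  rcases (hG.adj_iff _ _).1 hadj with h | ⟨a, ha, h⟩
  · obtain ⟨i, hic, hik, hui⟩ := hLH u h.fst_mem hu
    obtain ⟨-, j, huj, hu'j⟩ := (hH.adj_iff _ _).1 h
    by_cases hj : j ≠ c ∧ p j ≤ p k
    · exact ⟨hu'k, Or.inl ⟨j, hj.1, hj.2, hu'j⟩⟩
    exfalso
    rcases hH.eq_or_of_mem hui huj with rfl | ⟨rfl, rfl⟩ | ⟨rfl, rfl⟩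
    · exact hj ⟨hic, hik⟩
    · have hik' := (hLx i hic).1 hu
      by_cases hc : i + 1 = c
      · have := hlast i k hc
        omega
      · have := hsucc i hc
        exact hj ⟨hc, by omega⟩
    · have hjc : j ≠ c := fun h => huc (by rw [h])
      have := hsucc j hic
      exact hj ⟨hjc, by omega⟩
  · obtain ⟨j, rfl⟩ := hAx ha
    by_cases hj : j ≠ c ∧ p j < p k
    · exact ⟨hu'k, Or.inr ⟨j, hj.1, hj.2, ha, h.snd_mem⟩⟩
    exfalso
    rcases hu.2 with ⟨i, -, -, hui⟩ | ⟨i, hic, hik, hiA, hui⟩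
    · obtain rfl := hG.eq_of_mem ha (hH.mem_verts hui) h.fst_mem
      have hjc : j ≠ c := fun h => huc (by rw [h])
      exact hj ⟨hjc, (hLx j hjc).1 hu⟩
    · have := hH.injective (hG.center_eq hiA ha hui h.fst_mem)
      exact hj (this ▸ ⟨hic, hik⟩)

end Attaching

end SimpleGraph

theorem theorem5p5 {V : Type*} [Finite V] (G : SimpleGraph V) (r : ℕ) (hr : 1 ≤ r)
    (n : ℕ) (H : G.Subgraph) (B : ZMod n → Set V) (x : ZMod n → V)
    (hH : SimpleGraph.IsCliqueCycle H n B x)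
    (A : Set V) (hA : A.Nonempty) (hAx : A ⊆ Set.range x)
    (S : V → G.Subgraph) (hS : ∀ a ∈ A, SimpleGraph.IsStarClique (S a) a)
    (hG : SimpleGraph.IsAttaching G H A S)
    (hsize : ∃ a ∈ A, r + 1 ≤ (S a).verts.ncard) :
    Shelling.Shellable (G.indComplex r) := by
  classical
  obtain ⟨_, ha, hcard⟩ := hsize
  obtain ⟨a, rfl⟩ := hAx ha
  have hfin : (S (x a)).verts.Finite := Set.toFinite _
  have hmem : ∀ u, u ∈ hfin.toFinset ↔ u ∈ (S (x a)).verts := fun u => hfin.mem_toFinset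
  have hsmall : ∀ Y : Finset V, Y.card ≤ r → G.IsRIndep r Y := fun Y hY =>
    SimpleGraph.isRIndep_iff.2 fun K hK _ => (Finset.card_le_card hK).trans hY
  refine Shelling.ShellAbove.shellable _ ?_
  refine SimpleGraph.shellAbove_isRIndep_of_card G r x
    (fun v hv u u' => SimpleGraph.IsAttaching.simplicial hH hAx hS hG hv)
    (SimpleGraph.IsAttaching.lineOrdered hH hAx hG) hH.eq_univ_of_closed a hfin.toFinset
    ?_ ?_ ?_ _ ∅ le_rfl (hsmall ∅ (by simp))
    -- The induction starts in the third case of the invariant: singletons are independent because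
    -- `1 ≤ r`.
    (Or.inr (Or.inr ⟨fun u _ => hsmall _ (by simpa), by simp⟩))
  · rw [hmem]
    obtain ⟨t, C, -, -, hv, -⟩ := hS _ ha
    rw [hv]
    exact Or.inl rfl
  · rw [← Set.ncard_eq_toFinset_card _ hfin]
    exact hcard
  · intro u hu hua
    simp only [hmem] at hu ⊢
    exact SimpleGraph.IsAttaching.star hH hS hG ha hu hua
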